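/- A rational parametrization is a triple $x=(x^1,x^2,x^3)$ of rational functions in $\mathbb{R}(t)$, regarded as a rational map $x:\mathbb{R}\dashrightarrow\mathbb{R}^3$. The curve it defines is the Zariski closure in $\mathbb{R}^3$ of the set of points $x(t)$, where $t\in\mathbb{R}$ is not a pole. The parametrization is proper if it is birational onto its curve, i.e. there is a rational function $P/Q$ of three variables, with $Q$ not identically zero on the curve, such that $P(x(t))/Q(x(t))=t$. A similarity of (signed) ratio $\lambda$ is a map $f:\mathbb{R}^3\to\mathbb{R}^3$, $f(p)=\lambda Qp+b$, with $0\ne\lambda\in\mathbb{R}$, $b\in\mathbb{R}^3$, $Q\in\mathbb{R}^{3\times 3}$, $Q^{T}Q=I$ and $\det Q=1$. Let $x_1,x_2$ be proper rational parametrizations defining curves $C_1,C_2\subset\mathbb{R}^3$, neither of which is contained in a plane. For $i=1,2$ write the squared curvature and the torsion, which are rational functions of $t$, in lowest terms: $$\kappa_i^2=\frac{\|x_i'\times x_i''\|^2}{\|x_i'\|^6}=\frac{A_i}{B_i},\qquad \tau_i=\frac{\langle x_i'\times x_i'',x_i'''\rangle}{\|x_i'\times x_i''\|^2}=\frac{C_i}{D_i},$$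 where $A_i,B_i$ are coprime polynomials in $\mathbb{R}[t]$, and so are $C_i,D_i$ (here $C_i$ denotes a polynomial, not the curve). For $\lambda\in\mathbb{R}$ define in $\mathbb{R}[t,s]$ $$K_\lambda(t,s)=A_1(t)B_2(s)-\lambda^2A_2(s)B_1(t),\qquad T_\lambda(t,s)=C_1(t)D_2(s)-\lambda\,C_2(s)D_1(t),\qquad G_\lambda=\gcd(K_\lambda,T_\lambda).$$ Theorem. Let $\lambda_0\in\mathbb{R}$. There is a similarity $f$ of ratio $\lambda_0$ mapping the curve defined by $x_1$ onto the curve defined by $x_2$ if and only if there are $a,b,c,d\in\mathbb{R}$ with $ad-bc\neq0$ such that the polynomial $F(t,s)=(ct+d)s-(at+b)$ divides $G_{\lambda_0}$ and the Möbius transformation $\varphi(t)=\dfrac{at+b}{ct+d}$ satisfies $$|\lambda_0|\cdot\|x_1'(t)\|=\|(x_2\circ\varphi)'(t)\|$$ for all but finitely many $t\in\mathbb{R}$ (equivalently, wherever both sides are defined). -/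

import Mathlib

open Polynomial Filter

noncomputable section

namespace SpaceCurve

/-- Euclidean three-space. -/
abbrev E3 : Type := EuclideanSpace ℝ (Fin 3)

/-- A rational parametrization `ℝ ⇢ ℝ³`: a triple of rational functions of one variable. The
numerator and the denominator of each component (`RatFunc.num`, `RatFunc.denom`) are coprime. -/
abbrev RatParam : Type := Fin 3 → RatFunc ℝ

/-- The parametrization `x` is defined at `t`: no component has a pole there. -/
def DefinedAt (x : RatParam) (t : ℝ) : Prop :=
  ∀ i, (x i).denom.eval t ≠ 0

/-- The point `x(t)`, meaningful where `x` is defined. -/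
def point (x : RatParam) (t : ℝ) : E3 :=
  WithLp.toLp 2 fun i => (x i).eval (RingHom.id ℝ) t

/-- The algebraic curve parametrized by `x`: the Zariski closure in `ℝ³` of the set of all points
`x(t)`, with `t` real and not a pole of `x`. -/
def curve (x : RatParam) : Set E3 :=
  {p | ∀ P : MvPolynomial (Fin 3) ℝ,
    (∀ t, DefinedAt x t → MvPolynomial.eval (fun i => point x t i) P = 0) →
      MvPolynomial.eval (fun i => p i) P = 0}

/-- The parametrization `x` is proper, that is, birational onto its curve: there is a rational
function `P / Q` of three variables, whose denominator does not vanish identically on the curve,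
with `P(x(t)) / Q(x(t)) = t`. -/
def IsProper (x : RatParam) : Prop :=
  ∃ P Q : MvPolynomial (Fin 3) ℝ, MvPolynomial.aeval x Q ≠ 0 ∧
    MvPolynomial.aeval x P / MvPolynomial.aeval x Q = (RatFunc.X : RatFunc ℝ)

/-- A set of points is planar if some affine plane contains it. -/
def IsPlanar (C : Set E3) : Prop :=
  ∃ (n : E3) (h : ℝ), n ≠ 0 ∧ ∀ p ∈ C, inner ℝ n p = h

/-- `f` is a similarity of (signed) ratio `lam`: `f(p) = lam Q p + b` with `lam ≠ 0` and `Q` a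
special orthogonal matrix. -/
def IsSimilarity (lam : ℝ) (f : E3 → E3) : Prop :=
  lam ≠ 0 ∧ ∃ (Q : Matrix (Fin 3) (Fin 3) ℝ) (b : E3), Q.transpose * Q = 1 ∧ Q.det = 1 ∧
    ∀ p, f p = lam • Matrix.toEuclideanLin Q p + b

/-- The derivative of a rational function, by the quotient rule. -/
def ratDeriv (r : RatFunc ℝ) : RatFunc ℝ :=
  algebraMap ℝ[X] (RatFunc ℝ)
      (derivative r.num * r.denom - r.num * derivative r.denom) /
    algebraMap ℝ[X] (RatFunc ℝ) (r.denom ^ 2)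

/-- The componentwise derivative `x'` of a rational parametrization. -/
def velocity (x : RatParam) : RatParam := fun i => ratDeriv (x i)

/-- The squared curvature `κ² = ‖x' × x''‖² / ‖x'‖⁶`, as a rational function. -/
def curvatureSq (x : RatParam) : RatFunc ℝ :=
  let x₁ := velocity x
  let x₂ := velocity x₁
  (crossProduct x₁ x₂ ⬝ᵥ crossProduct x₁ x₂) / (x₁ ⬝ᵥ x₁) ^ 3

/-- The torsion `τ = ⟨x' × x'', x'''⟩ / ‖x' × x''‖²`, as a rational function. -/
def torsion (x : RatParam) : RatFunc ℝ :=
  let x₁ := velocity x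
  let x₂ := velocity x₁
  let x₃ := velocity x₂
  (crossProduct x₁ x₂ ⬝ᵥ x₃) / (crossProduct x₁ x₂ ⬝ᵥ crossProduct x₁ x₂)

/-- Polynomials in `t, s`, as polynomials in `s` with coefficients in `ℝ[t]`. -/
abbrev BiPoly : Type := Polynomial (Polynomial ℝ)

/-- `p(t)` as a polynomial in `t, s`. -/
def inT (p : ℝ[X]) : BiPoly := C p

/-- `p(s)` as a polynomial in `t, s`. -/
def inS (p : ℝ[X]) : BiPoly := p.map C

/-- For `r₁ = A₁ / B₁` and `r₂ = A₂ / B₂` in lowest terms, the polynomial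
`A₁(t) B₂(s) - m A₂(s) B₁(t)`, obtained by clearing denominators in `r₁(t) - m r₂(s) = 0`. -/
def cleared (r₁ r₂ : RatFunc ℝ) (m : ℝ) : BiPoly :=
  inT r₁.num * inS r₂.denom - C (C m) * (inS r₂.num * inT r₁.denom)

/-- `K_lam`, from `κ₁²(t) - lam² κ₂²(s) = 0`. -/
def polyK (x₁ x₂ : RatParam) (lam : ℝ) : BiPoly :=
  cleared (curvatureSq x₁) (curvatureSq x₂) (lam ^ 2)

/-- `T_lam`, from `τ₁(t) - lam τ₂(s) = 0`. -/
def polyT (x₁ x₂ : RatParam) (lam : ℝ) : BiPoly :=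
  cleared (torsion x₁) (torsion x₂) lam

/-- A greatest common divisor of two polynomials in `t, s` (unique up to a nonzero constant). -/
def biGcd (p q : BiPoly) : BiPoly :=
  letI := UniqueFactorizationMonoid.toGCDMonoid BiPoly
  gcd p q

/-- `G_lam = gcd (K_lam, T_lam)`. -/
def polyG (x₁ x₂ : RatParam) (lam : ℝ) : BiPoly :=
  biGcd (polyK x₁ x₂ lam) (polyT x₁ x₂ lam)

/-- The polynomial `F(t, s) = (c t + d) s - (a t + b)`. -/
def moebiusPoly (a b c d : ℝ) : BiPoly :=
  inT (C c * X + C d) * inS X - inT (C a * X + C b)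

/-- The map `t ↦ (a t + b) / (c t + d)`. -/
def moebius (a b c d t : ℝ) : ℝ := (a * t + b) / (c * t + d)

/-- The arc-length relation `|lam| ‖x₁'(t)‖ = ‖(x₂ ∘ φ)'(t)‖`, at all `t` except the finitely
many at which one of the two sides is not defined. -/
def ArcLengthRelation (x₁ x₂ : RatParam) (lam : ℝ) (φ : ℝ → ℝ) : Prop :=
  ∀ᶠ t in cofinite, |lam| * ‖deriv (point x₁) t‖ = ‖deriv (point x₂ ∘ φ) t‖

end SpaceCurve

end

noncomputable section

namespace SpaceCurve

/-! ### The derivation on rational functions -/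

/-! Everything takes place in the differential field `ℝ(t)`. A curve is determined by the ideal of
polynomials vanishing at its parametrization (`curve_eq_curve_iff`), and a substitution `t ↦ φ(t)`
is an `ℝ`-algebra endomorphism `σ` of `ℝ(t)`.

Suppose a similarity maps the first curve onto the second. Then its composite `y` with `x₁` has the
same ideal as `x₂`. Since `x₂` is proper, `x₂ ↦ y` extends to an endomorphism `σ`
(`exists_algHom_of_aeval_eq_zero_iff`). Since `x₁` is proper, `y` generates `ℝ(t)`, so `σ` is an
automorphism, hence a Möbius substitution. Curvature and torsion commute with `σ` and scale under
similarities, which gives the relations `κ₁² = λ² κ₂² ∘ φ` and `τ₁ = λ τ₂ ∘ φ`. By Gauss's lemma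
these say exactly that `F` divides `G` (`moebiusPoly_dvd_polyG_iff`).

Conversely, put `y = x₂ ∘ φ`. Speed, curvature and torsion determine the Gram matrix of the first
three derivatives (`gram_jet_eq`). Hence the derivatives of `y` are `λ` times those of `x₁`
multiplied by an orthogonal matrix over `ℝ(t)`. A skew-symmetry argument shows that this matrix is
constant (`map_ratD_eq_zero_of_jet_eq`), so `y` is a similar image of `x₁`. This replaces the Frenet
equations and needs neither square roots nor arc-length parametrization. -/

theorem ratDeriv_div (p q : ℝ[X]) (hq : q ≠ 0) :
    ratDeriv (algebraMap ℝ[X] (RatFunc ℝ) p / algebraMap ℝ[X] (RatFunc ℝ) q) =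
      algebraMap ℝ[X] (RatFunc ℝ) (derivative p * q - p * derivative q) /
        algebraMap ℝ[X] (RatFunc ℝ) (q ^ 2) := by
  obtain ⟨r, hr⟩ : ∃ r, algebraMap ℝ[X] (RatFunc ℝ) p / algebraMap ℝ[X] (RatFunc ℝ) q = r :=
    ⟨_, rfl⟩
  rw [hr]
  have hd := r.denom_ne_zero
  have h : r.num * q = p * r.denom := (RatFunc.num_mul_eq_mul_denom_iff hq).2 hr.symm
  -- Differentiating the cross-multiplied identity shows that the quotient rule is independent of
  -- the fraction chosen.
  have h' := congrArg derivative h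
  simp only [derivative_mul] at h'
  unfold ratDeriv
  rw [div_eq_div_iff (RatFunc.algebraMap_ne_zero (pow_ne_zero 2 hd))
    (RatFunc.algebraMap_ne_zero (pow_ne_zero 2 hq)), ← map_mul, ← map_mul]
  generalize r.num = n at *
  generalize r.denom = d at *
  refine congrArg _ ?_
  linear_combination (q * d) * h' - (d * derivative q + derivative d * q) * h

theorem ratDeriv_add (r s : RatFunc ℝ) : ratDeriv (r + s) = ratDeriv r + ratDeriv s := by
  induction r using RatFunc.induction_on with | _ p q hq =>
  induction s using RatFunc.induction_on with | _ p' q' hq' =>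
  have h := RatFunc.algebraMap_ne_zero hq
  have h' := RatFunc.algebraMap_ne_zero hq'
  rw [div_add_div _ _ h h', ← map_mul, ← map_mul, ← map_mul, ← map_add,
    ratDeriv_div _ _ (mul_ne_zero hq hq'), ratDeriv_div _ _ hq, ratDeriv_div _ _ hq']
  simp only [derivative_mul, map_add, map_sub, map_mul, map_pow]
  field_simp
  ring

theorem ratDeriv_mul (r s : RatFunc ℝ) : ratDeriv (r * s) = r * ratDeriv s + s * ratDeriv r := by
  induction r using RatFunc.induction_on with | _ p q hq =>
  induction s using RatFunc.induction_on with | _ p' q' hq' =>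
  have h := RatFunc.algebraMap_ne_zero hq
  have h' := RatFunc.algebraMap_ne_zero hq'
  rw [div_mul_div_comm, ← map_mul, ← map_mul,
    ratDeriv_div _ _ (mul_ne_zero hq hq'), ratDeriv_div _ _ hq, ratDeriv_div _ _ hq']
  simp only [derivative_mul, map_add, map_sub, map_mul, map_pow]
  field_simp
  ring

theorem ratDeriv_algebraMap (p : ℝ[X]) :
    ratDeriv (algebraMap ℝ[X] (RatFunc ℝ) p) = algebraMap ℝ[X] (RatFunc ℝ) (derivative p) := by
  simpa using ratDeriv_div p 1 one_ne_zero

theorem ratDeriv_C (c : ℝ) : ratDeriv (RatFunc.C c) = 0 := by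
  rw [← RatFunc.algebraMap_C, ratDeriv_algebraMap]; simp

/-- `ratDeriv` as a derivation. -/
def ratD : Derivation ℝ (RatFunc ℝ) (RatFunc ℝ) where
  toFun := ratDeriv
  map_add' := ratDeriv_add
  map_smul' c r := by
    simp [RatFunc.smul_eq_C_mul, ratDeriv_mul, ratDeriv_C]
  map_one_eq_zero' := by
    have := ratDeriv_C 1
    simpa using this
  leibniz' r s := by simp [ratDeriv_mul]

theorem ratD_apply (r : RatFunc ℝ) : ratD r = ratDeriv r := rfl

theorem ratD_mul (r s : RatFunc ℝ) : ratD (r * s) = r * ratD s + s * ratD r := ratDeriv_mul r s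

@[simp]
theorem ratD_C (c : ℝ) : ratD (RatFunc.C c) = 0 := ratDeriv_C c

theorem ratD_X : ratD RatFunc.X = 1 := by
  rw [ratD_apply, ← RatFunc.algebraMap_X, ratDeriv_algebraMap]; simp

/-- The constants of the derivation are the real numbers. -/
theorem exists_eq_C_of_ratD_eq_zero {r : RatFunc ℝ} (h : ratD r = 0) : ∃ c, r = RatFunc.C c := by
  have hd := r.denom_ne_zero
  have h1 : derivative r.num * r.denom = r.num * derivative r.denom := by
    rw [ratD_apply, ratDeriv, div_eq_zero_iff,
      or_iff_left (RatFunc.algebraMap_ne_zero (pow_ne_zero 2 hd))] at h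
    rw [← sub_eq_zero]
    exact RatFunc.algebraMap_injective ℝ (by rw [h, map_zero])
  -- By coprimality the denominator divides its own derivative, which has smaller degree and so must
  -- vanish.
  have hdvd : r.denom ∣ derivative r.denom :=
    (RatFunc.isCoprime_num_denom r).symm.dvd_of_dvd_mul_left ⟨derivative r.num, by
      rw [← h1, mul_comm]⟩
  have hd0 : derivative r.denom = 0 := by
    by_contra hne
    exact absurd (degree_le_of_dvd hdvd hne) (not_le.2 (degree_derivative_lt hd))
  have hn0 : derivative r.num = 0 := by
    rw [hd0, mul_zero] at h1
    exact (mul_eq_zero.1 h1).resolve_right hd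
  have e1 := eq_C_of_derivative_eq_zero hn0
  have e2 := eq_C_of_derivative_eq_zero hd0
  refine ⟨r.num.coeff 0 / r.denom.coeff 0, ?_⟩
  conv_lhs => rw [← RatFunc.num_div_denom r, e1, e2]
  rw [RatFunc.algebraMap_C, RatFunc.algebraMap_C, map_div₀]

/-- The chain rule. -/
theorem ratD_algHom (σ : RatFunc ℝ →ₐ[ℝ] RatFunc ℝ) (r : RatFunc ℝ) :
    ratD (σ r) = σ (ratD r) * ratD (σ RatFunc.X) := by
  have hp : ∀ p : ℝ[X], ratD (σ (algebraMap ℝ[X] (RatFunc ℝ) p)) =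
      σ (ratD (algebraMap ℝ[X] (RatFunc ℝ) p)) * ratD (σ RatFunc.X) := by
    intro p
    have : σ (algebraMap ℝ[X] (RatFunc ℝ) p) = aeval (σ RatFunc.X) p := by
      rw [← RatFunc.aeval_X_left_eq_algebraMap, aeval_algHom_apply]
    rw [this, ratD_apply (algebraMap _ _ p), ratDeriv_algebraMap,
      ← RatFunc.aeval_X_left_eq_algebraMap (derivative p), Derivation.map_aeval, smul_eq_mul,
      aeval_algHom_apply]
  induction r using RatFunc.induction_on with | _ p q hq =>
  have h := RatFunc.algebraMap_ne_zero hq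
  have h' : σ (algebraMap ℝ[X] (RatFunc ℝ) q) ≠ 0 := by simpa using h
  rw [map_div₀, Derivation.leibniz_div, Derivation.leibniz_div, hp, hp]
  simp only [smul_eq_mul, map_mul, map_sub, map_pow, map_inv₀]
  ring

/-! ### Evaluation of rational functions -/

/-- The value at `t`, with value `0` at the poles. -/
def val (r : RatFunc ℝ) (t : ℝ) : ℝ := r.eval (RingHom.id ℝ) t

theorem val_eq (r : RatFunc ℝ) (t : ℝ) : val r t = r.num.eval t / r.denom.eval t := rfl

theorem eventually_eval_ne_zero {p : ℝ[X]} (hp : p ≠ 0) : ∀ᶠ t in cofinite, p.eval t ≠ 0 := by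
  simpa [eventually_cofinite] using Polynomial.finite_setOfPred_isRoot hp

theorem eventually_denom_ne_zero (r : RatFunc ℝ) : ∀ᶠ t in cofinite, r.denom.eval t ≠ 0 :=
  eventually_eval_ne_zero r.denom_ne_zero

theorem eventually_val_ne_zero {r : RatFunc ℝ} (hr : r ≠ 0) : ∀ᶠ t in cofinite, val r t ≠ 0 := by
  filter_upwards [eventually_eval_ne_zero (RatFunc.num_ne_zero hr), eventually_denom_ne_zero r]
    with t h1 h2
  exact div_ne_zero h1 h2

theorem eq_zero_of_eventually_val {r : RatFunc ℝ} (h : ∀ᶠ t in cofinite, val r t = 0) : r = 0 := by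
  by_contra hr
  obtain ⟨t, h1, h2⟩ := (h.and (eventually_val_ne_zero hr)).exists
  exact h2 h1

theorem val_add {r s : RatFunc ℝ} {t : ℝ} (hr : r.denom.eval t ≠ 0) (hs : s.denom.eval t ≠ 0) :
    val (r + s) t = val r t + val s t := RatFunc.eval_add (f := RingHom.id ℝ) (a := t) hr hs

theorem val_mul {r s : RatFunc ℝ} {t : ℝ} (hr : r.denom.eval t ≠ 0) (hs : s.denom.eval t ≠ 0) :
    val (r * s) t = val r t * val s t := RatFunc.eval_mul (f := RingHom.id ℝ) (a := t) hr hs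

@[simp]
theorem val_C (c t : ℝ) : val (RatFunc.C c) t = c := by simp [val]

theorem val_algebraMap (p : ℝ[X]) (t : ℝ) :
    val (algebraMap ℝ[X] (RatFunc ℝ) p) t = p.eval t := by simp [val_eq]

theorem eventually_val_add (r s : RatFunc ℝ) :
    ∀ᶠ t in cofinite, val (r + s) t = val r t + val s t := by
  filter_upwards [eventually_denom_ne_zero r, eventually_denom_ne_zero s] with t h1 h2
  exact val_add h1 h2

theorem eventually_val_mul (r s : RatFunc ℝ) :
    ∀ᶠ t in cofinite, val (r * s) t = val r t * val s t := by
  filter_upwards [eventually_denom_ne_zero r, eventually_denom_ne_zero s] with t h1 h2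
  exact val_mul h1 h2

theorem eventually_val_div (r : RatFunc ℝ) {s : RatFunc ℝ} (hs : s ≠ 0) :
    ∀ᶠ t in cofinite, val (r / s) t = val r t / val s t := by
  filter_upwards [eventually_val_mul (r / s) s, eventually_val_ne_zero hs] with t h1 h2
  rw [eq_div_iff h2, ← h1, div_mul_cancel₀ r hs]

theorem eventually_val_aeval (φ : RatFunc ℝ) (p : ℝ[X]) :
    ∀ᶠ t in cofinite, val (aeval φ p) t = p.eval (val φ t) := by
  induction p using Polynomial.induction_on with
  | C a =>
    refine Eventually.of_forall fun t => ?_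
    rw [aeval_C, RatFunc.algebraMap_eq_C, val_C, eval_C]
  | add p q hp hq =>
    filter_upwards [hp, hq, eventually_val_add (aeval φ p) (aeval φ q)] with t h1 h2 h3
    rw [map_add, h3, h1, h2, eval_add]
  | monomial n a h =>
    filter_upwards [h, eventually_val_mul (aeval φ (C a * X ^ n)) φ] with t h1 h2
    rw [pow_succ, ← mul_assoc, map_mul, aeval_X, h2, h1, eval_mul_X]

theorem algHom_eq_aeval_div (σ : RatFunc ℝ →ₐ[ℝ] RatFunc ℝ) (r : RatFunc ℝ) :
    σ r = aeval (σ RatFunc.X) r.num / aeval (σ RatFunc.X) r.denom := by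
  conv_lhs => rw [← RatFunc.num_div_denom r]
  rw [map_div₀, aeval_algHom_apply, aeval_algHom_apply, RatFunc.aeval_X_left_eq_algebraMap,
    RatFunc.aeval_X_left_eq_algebraMap]

theorem eventually_val_algHom (σ : RatFunc ℝ →ₐ[ℝ] RatFunc ℝ) (r : RatFunc ℝ) :
    ∀ᶠ t in cofinite, val (σ r) t = val r (val (σ RatFunc.X) t) := by
  have hd : aeval (σ RatFunc.X) r.denom ≠ 0 := by
    rw [aeval_algHom_apply, RatFunc.aeval_X_left_eq_algebraMap]
    simpa using RatFunc.algebraMap_ne_zero r.denom_ne_zero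
  filter_upwards [eventually_val_aeval (σ RatFunc.X) r.num,
    eventually_val_aeval (σ RatFunc.X) r.denom,
    eventually_val_div (aeval (σ RatFunc.X) r.num) hd] with t h1 h2 h3
  rw [algHom_eq_aeval_div, h3, h1, h2, val_eq r]

theorem hasDerivAt_val {r : RatFunc ℝ} {t : ℝ} (ht : r.denom.eval t ≠ 0) :
    HasDerivAt (val r) ((derivative r.num * r.denom - r.num * derivative r.denom).eval t /
      (r.denom ^ 2).eval t) t := by
  have := (r.num.hasDerivAt t).div (r.denom.hasDerivAt t) ht
  simp only [eval_sub, eval_mul, eval_pow]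
  exact this

theorem eventually_hasDerivAt_val (r : RatFunc ℝ) :
    ∀ᶠ t in cofinite, HasDerivAt (val r) (val (ratD r) t) t := by
  filter_upwards [eventually_denom_ne_zero r, eventually_val_div
    (algebraMap ℝ[X] (RatFunc ℝ) (derivative r.num * r.denom - r.num * derivative r.denom))
    (RatFunc.algebraMap_ne_zero (pow_ne_zero 2 r.denom_ne_zero))] with t h1 h2
  rw [ratD_apply, ratDeriv, h2, val_algebraMap, val_algebraMap]
  exact hasDerivAt_val h1

/-! ### Curves and ideals -/

theorem point_apply (x : RatParam) (t : ℝ) (i : Fin 3) : point x t i = val (x i) t := rfl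

theorem eventually_definedAt (x : RatParam) : ∀ᶠ t in cofinite, DefinedAt x t :=
  eventually_all.2 fun i => eventually_denom_ne_zero (x i)

/-- The absence of a pole is carried through the induction because `val` is additive and
multiplicative only away from poles. -/
theorem val_aeval_mvPolynomial {x : RatParam} {t : ℝ} (ht : DefinedAt x t)
    (P : MvPolynomial (Fin 3) ℝ) :
    (MvPolynomial.aeval x P).denom.eval t ≠ 0 ∧
      val (MvPolynomial.aeval x P) t = MvPolynomial.eval (fun i => point x t i) P := by
  have ne_of_dvd : ∀ {p q : ℝ[X]}, p ∣ q → q.eval t ≠ 0 → p.eval t ≠ 0 := by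
    rintro p _ ⟨q, rfl⟩ h h0
    exact h (by rw [eval_mul, h0, zero_mul])
  induction P using MvPolynomial.induction_on with
  | C a => simp [RatFunc.algebraMap_eq_C]
  | add P Q hP hQ =>
    refine ⟨?_, ?_⟩
    · rw [map_add]
      exact ne_of_dvd (RatFunc.denom_add_dvd _ _) (by rw [eval_mul]; exact mul_ne_zero hP.1 hQ.1)
    · rw [map_add, val_add hP.1 hQ.1, hP.2, hQ.2, map_add]
  | mul_X P i hP =>
    refine ⟨?_, ?_⟩
    · rw [map_mul, MvPolynomial.aeval_X]
      exact ne_of_dvd (RatFunc.denom_mul_dvd _ _) (by rw [eval_mul]; exact mul_ne_zero hP.1 (ht i))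
    · rw [map_mul, MvPolynomial.aeval_X, val_mul hP.1 (ht i), hP.2, map_mul, MvPolynomial.eval_X,
        point_apply]

theorem aeval_eq_zero_iff (x : RatParam) (P : MvPolynomial (Fin 3) ℝ) :
    MvPolynomial.aeval x P = 0 ↔
      ∀ t, DefinedAt x t → MvPolynomial.eval (fun i => point x t i) P = 0 := by
  refine ⟨fun h t ht => ?_, fun h => eq_zero_of_eventually_val ?_⟩
  · rw [← (val_aeval_mvPolynomial ht P).2, h]
    simp [val_eq]
  · filter_upwards [eventually_definedAt x] with t ht
    rw [(val_aeval_mvPolynomial ht P).2, h t ht]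

theorem mem_curve_iff (x : RatParam) (p : E3) :
    p ∈ curve x ↔ ∀ P : MvPolynomial (Fin 3) ℝ, MvPolynomial.aeval x P = 0 →
      MvPolynomial.eval (fun i => p i) P = 0 := by
  simp only [curve, Set.mem_ofPred_eq, aeval_eq_zero_iff]

theorem point_mem_curve (x : RatParam) {t : ℝ} (ht : DefinedAt x t) : point x t ∈ curve x :=
  fun _ hP => hP t ht

/-- A polynomial vanishes on the curve if and only if it vanishes at the parametrization. -/
theorem forall_mem_curve_iff (x : RatParam) (P : MvPolynomial (Fin 3) ℝ) :
    (∀ p ∈ curve x, MvPolynomial.eval (fun i => p i) P = 0) ↔ MvPolynomial.aeval x P = 0 :=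
  ⟨fun h => (aeval_eq_zero_iff x P).2 fun _ ht => h _ (point_mem_curve x ht),
    fun h p hp => (mem_curve_iff x p).1 hp P h⟩

/-- A set and its Zariski closure have the same vanishing ideal, so no Nullstellensatz is involved.
-/
theorem curve_eq_curve_iff (x y : RatParam) :
    curve x = curve y ↔ ∀ P : MvPolynomial (Fin 3) ℝ,
      MvPolynomial.aeval x P = 0 ↔ MvPolynomial.aeval y P = 0 := by
  refine ⟨fun h P => ?_, fun h => ?_⟩
  · rw [← forall_mem_curve_iff, ← forall_mem_curve_iff, h]
  · ext p
    simp only [mem_curve_iff, h]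

/-- A field homomorphism is injective, so the substitution leaves the vanishing ideal unchanged. -/
theorem curve_algHom (σ : RatFunc ℝ →ₐ[ℝ] RatFunc ℝ) (x : RatParam) :
    curve (fun i => σ (x i)) = curve x := by
  rw [curve_eq_curve_iff]
  intro P
  have : MvPolynomial.aeval (fun i => σ (x i)) P = σ (MvPolynomial.aeval x P) := by
    rw [← MvPolynomial.comp_aeval_apply]
  rw [this, map_eq_zero]

/-! ### Affine images of curves -/

/-- The image of a parametrization under the affine map with matrix `M` and translation `b`. -/
def affineImage (M : Matrix (Fin 3) (Fin 3) ℝ) (b : Fin 3 → ℝ) (x : RatParam) : RatParam :=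
  fun i => ∑ j, RatFunc.C (M i j) * x j + RatFunc.C (b i)

theorem map_mem_curve_affineImage (M : Matrix (Fin 3) (Fin 3) ℝ) (b : Fin 3 → ℝ) (x : RatParam)
    {p q : E3} (hp : p ∈ curve x) (hq : ∀ i, q i = ∑ j, M i j * p j + b i) :
    q ∈ curve (affineImage M b x) := by
  rw [mem_curve_iff] at hp ⊢
  intro P hP
  let S : Fin 3 → MvPolynomial (Fin 3) ℝ := fun i =>
    ∑ j, MvPolynomial.C (M i j) * MvPolynomial.X j + MvPolynomial.C (b i)
  have h1 : MvPolynomial.aeval x (MvPolynomial.bind₁ S P) = 0 := by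
    rw [← hP, MvPolynomial.aeval_bind₁]
    -- Pulling `P` back along the affine map turns a relation of the image into a relation of `x`.
    congr 2
    ext1 i
    simp [S, affineImage, RatFunc.algebraMap_eq_C]
  have h2 := hp _ h1
  rw [← MvPolynomial.coe_aeval_eq_eval, RingHom.coe_coe, MvPolynomial.aeval_bind₁] at h2
  rw [← h2, ← MvPolynomial.coe_aeval_eq_eval, RingHom.coe_coe]
  congr 2
  ext1 i
  simp [S, hq]

theorem affineImage_affineImage_inv (M : Matrix (Fin 3) (Fin 3) ℝ) (N : Matrix (Fin 3) (Fin 3) ℝ)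
    (b : Fin 3 → ℝ) (h : N * M = 1) (x : RatParam) :
    affineImage N (fun i => -∑ j, N i j * b j) (affineImage M b x) = x := by
  have e : ∀ i k, ∑ j, N i j * M j k = if i = k then 1 else 0 := fun i k => by
    rw [← Matrix.mul_apply, h, Matrix.one_apply]
  funext i
  have e0 := congrArg RatFunc.C (e i 0)
  have e1 := congrArg RatFunc.C (e i 1)
  have e2 := congrArg RatFunc.C (e i 2)
  simp only [Fin.sum_univ_three, map_add, map_mul] at e0 e1 e2
  have : x i = RatFunc.C (if i = 0 then 1 else 0) * x 0 + RatFunc.C (if i = 1 then 1 else 0) * x 1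
      + RatFunc.C (if i = 2 then 1 else 0) * x 2 := by
    fin_cases i <;> simp
  rw [this]
  simp only [affineImage, Fin.sum_univ_three, map_add, map_mul, map_neg]
  linear_combination x 0 * e0 + x 1 * e1 + x 2 * e2

theorem similarity_apply {lam : ℝ} {f : E3 → E3} {Q : Matrix (Fin 3) (Fin 3) ℝ} {b : E3}
    (hf : ∀ p, f p = lam • Matrix.toEuclideanLin Q p + b) (p : E3) (i : Fin 3) :
    f p i = ∑ j, (lam • Q) i j * p j + b i := by
  rw [hf]
  simp [Matrix.toEuclideanLin, Matrix.mulVec, dotProduct, Finset.mul_sum, mul_assoc]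

theorem image_curve {lam : ℝ} (hlam : lam ≠ 0) {f : E3 → E3} {Q : Matrix (Fin 3) (Fin 3) ℝ}
    {b : E3} (hQ : Q.transpose * Q = 1)
    (hf : ∀ p, f p = lam • Matrix.toEuclideanLin Q p + b) (x : RatParam) :
    f '' curve x = curve (affineImage (lam • Q) (fun i => b i) x) := by
  have hNM : (lam⁻¹ • Q.transpose) * (lam • Q) = 1 := by
    rw [Matrix.smul_mul, Matrix.mul_smul, smul_smul, inv_mul_cancel₀ hlam, one_smul, hQ]
  have hMN : (lam • Q) * (lam⁻¹ • Q.transpose) = 1 := mul_eq_one_comm.1 hNM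
  ext q
  constructor
  · rintro ⟨p, hp, rfl⟩
    exact map_mem_curve_affineImage _ _ x hp (similarity_apply hf p)
  · intro hq
    set N := lam⁻¹ • Q.transpose with hN
    -- The preimage under the inverse affine map, which has matrix `N` and translation `-N b`.
    let p : E3 := WithLp.toLp 2 fun i => ∑ j, N i j * q j + -∑ j, N i j * b j
    refine ⟨p, ?_, ?_⟩
    · have := map_mem_curve_affineImage N (fun i => -∑ j, N i j * b j) _ hq (q := p)
        fun i => rfl
      rwa [affineImage_affineImage_inv _ _ _ hNM] at this
    · ext i
      rw [similarity_apply hf]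
      have e : ∀ k, ∑ j, (lam • Q) i j * N j k = if i = k then 1 else 0 := fun k => by
        rw [← Matrix.mul_apply, hMN, Matrix.one_apply]
      have e0 := e 0
      have e1 := e 1
      have e2 := e 2
      have hq' : ∀ v : E3, v i = (if i = 0 then 1 else 0) * v 0 + (if i = 1 then 1 else 0) * v 1 +
          (if i = 2 then 1 else 0) * v 2 := by
        intro v; fin_cases i <;> simp
      have hq0 := hq' q
      have hb0 := hq' b
      rw [hq0, hb0]
      simp only [Fin.sum_univ_three, p] at e0 e1 e2 ⊢
      linear_combination (q 0 - b 0) * e0 + (q 1 - b 1) * e1 + (q 2 - b 2) * e2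

/-! ### Vectors of rational functions -/

theorem velocity_apply (x : RatParam) (i : Fin 3) : velocity x i = ratD (x i) := rfl

theorem ratD_dotProduct (u v : RatParam) :
    ratD (u ⬝ᵥ v) = velocity u ⬝ᵥ v + u ⬝ᵥ velocity v := by
  simp only [dotProduct, Fin.sum_univ_three, map_add, ratD_mul, velocity_apply]
  ring

theorem velocity_crossProduct (u v : RatParam) :
    velocity (crossProduct u v) = crossProduct (velocity u) v + crossProduct u (velocity v) := by
  funext i
  fin_cases i <;>
    simp [velocity_apply, cross_apply] <;> ring

/-- The triple product of the first three derivatives. -/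
def tripleDet (x : RatParam) : RatFunc ℝ :=
  crossProduct (velocity x) (velocity (velocity x)) ⬝ᵥ velocity (velocity (velocity x))

theorem eventually_norm_point_sq (u : RatParam) :
    ∀ᶠ t in cofinite, ‖point u t‖ ^ 2 = val (u ⬝ᵥ u) t := by
  filter_upwards [eventually_val_mul (u 0) (u 0), eventually_val_mul (u 1) (u 1),
      eventually_val_mul (u 2) (u 2), eventually_val_add (u 0 * u 0) (u 1 * u 1),
      eventually_val_add (u 0 * u 0 + u 1 * u 1) (u 2 * u 2)] with t h0 h1 h2 h3 h4
  rw [EuclideanSpace.norm_sq_eq, Matrix.vec3_dotProduct, h4, h3, h0, h1, h2]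
  simp only [Fin.sum_univ_three, point_apply, Real.norm_eq_abs, sq_abs]
  ring

/-- The field of real rational functions is formally real. -/
theorem eq_zero_of_dotProduct_self {u : RatParam} (h : u ⬝ᵥ u = 0) : u = 0 := by
  funext i
  apply eq_zero_of_eventually_val
  filter_upwards [eventually_norm_point_sq u] with t ht
  rw [h, val_eq, RatFunc.num_zero, eval_zero, zero_div, sq_eq_zero_iff, norm_eq_zero] at ht
  rw [← point_apply, ht, PiLp.zero_apply]

/-- A vector parallel to its derivative has a constant direction. -/
theorem exists_constant_direction {w : RatParam} (hw : w ≠ 0)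
    (h : crossProduct w (velocity w) = 0) :
    ∃ (c : Fin 3 → ℝ) (r : RatFunc ℝ), c ≠ 0 ∧ r ≠ 0 ∧ ∀ i, w i = RatFunc.C (c i) * r := by
  obtain ⟨i, hi⟩ := Function.ne_iff.1 hw
  rw [Pi.zero_apply] at hi
  -- The components of `w × w' = 0`, up to sign; they say that each `w j / w i` has derivative zero.
  have hpar : ∀ j, w i * ratD (w j) = w j * ratD (w i) := by
    intro j
    have h0 := congrFun h 0
    have h1 := congrFun h 1
    have h2 := congrFun h 2
    simp [cross_apply, velocity_apply] at h0 h1 h2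
    fin_cases i <;> fin_cases j <;>
      simp only [Fin.zero_eta, Fin.mk_one, Fin.reduceFinMk] <;>
      first
        | ring1
        | linear_combination h0
        | linear_combination h1
        | linear_combination h2
        | linear_combination -h0
        | linear_combination -h1
        | linear_combination -h2
  have hconst : ∀ j, ∃ c, w j / w i = RatFunc.C c := fun j => by
    apply exists_eq_C_of_ratD_eq_zero
    simp [Derivation.leibniz_div, hpar j]
  choose c hc using hconst
  refine ⟨c, w i, fun h0 => ?_, hi, fun j => by rw [← hc, div_mul_cancel₀ _ hi]⟩
  have := hc i
  rw [div_self hi, h0] at this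
  simp at this

/-- The function `⟨n, x⟩` has derivative zero, so it is constant, and this linear equation passes to
the Zariski closure. -/
theorem isPlanar_of_orthogonal {x : RatParam} {n : Fin 3 → ℝ} (hn : n ≠ 0)
    (h : ∑ i, RatFunc.C (n i) * ratD (x i) = 0) : IsPlanar (curve x) := by
  obtain ⟨c, hc⟩ : ∃ c, ∑ i, RatFunc.C (n i) * x i = RatFunc.C c := by
    apply exists_eq_C_of_ratD_eq_zero
    rw [← h]
    simp [map_sum]
  refine ⟨WithLp.toLp 2 n, c, fun h0 => hn ?_, fun p hp => ?_⟩
  · simpa using h0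
  · have := (mem_curve_iff x p).1 hp
      (∑ i, MvPolynomial.C (n i) * MvPolynomial.X i - MvPolynomial.C c) (by
        simp [RatFunc.algebraMap_eq_C, hc])
    simp only [map_sub, map_sum, map_mul, MvPolynomial.eval_C, MvPolynomial.eval_X,
      sub_eq_zero] at this
    rw [← this]
    simp [PiLp.inner_apply, mul_comm]

theorem exists_orthogonal (c : Fin 3 → ℝ) : ∃ n : Fin 3 → ℝ, n ≠ 0 ∧ ∑ i, n i * c i = 0 := by
  by_cases h : c 0 = 0 ∧ c 1 = 0
  · refine ⟨![1, 0, 0], fun h0 => by simpa using congrFun h0 0, ?_⟩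
    simp [Fin.sum_univ_three, h.1]
  · refine ⟨![c 1, -c 0, 0], fun h0 => h ⟨?_, ?_⟩, ?_⟩
    · simpa using congrFun h0 1
    · simpa using congrFun h0 0
    · simp [Fin.sum_univ_three]; ring

/-- Let `w = x' × x''`. If `w = 0`, then `x'` is zero or has a constant direction. Otherwise `w × w'
= det(x', x'', x''') x' = 0`, so `w` has a constant direction, and this direction is normal to `x'`.
-/
theorem tripleDet_ne_zero {x : RatParam} (hx : ¬ IsPlanar (curve x)) : tripleDet x ≠ 0 := by
  intro hdet
  apply hx
  set u := velocity x with hu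
  by_cases hw : crossProduct u (velocity u) = 0
  · by_cases hu0 : u = 0
    · refine isPlanar_of_orthogonal (n := fun _ => 1) (fun h => ?_) ?_
      · simpa using congrFun h 0
      · simp [← velocity_apply, ← hu, hu0]
    · obtain ⟨c, r, -, -, hcr⟩ := exists_constant_direction hu0 hw
      obtain ⟨n, hn, hnc⟩ := exists_orthogonal c
      refine isPlanar_of_orthogonal hn ?_
      simp only [← velocity_apply, ← hu, hcr, ← mul_assoc, ← map_mul, ← Finset.sum_mul, ← map_sum,
        hnc, map_zero, zero_mul]
  · have hpar : crossProduct (crossProduct u (velocity u))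
        (velocity (crossProduct u (velocity u))) = 0 := by
      have hd : crossProduct u (velocity u) ⬝ᵥ velocity (velocity u) = 0 := hdet
      rw [velocity_crossProduct, cross_self, zero_add]
      rw [Matrix.vec3_dotProduct] at hd
      generalize velocity (velocity u) = a at *
      generalize velocity u = b at *
      simp only [cross_apply, Matrix.cons_val] at hd ⊢
      funext i
      fin_cases i <;> simp
      · linear_combination u 0 * hd
      · linear_combination u 1 * hd
      · linear_combination u 2 * hd
    obtain ⟨c, r, hc, hr, hcr⟩ := exists_constant_direction hw hpar
    refine isPlanar_of_orthogonal hc ?_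
    have h0 := dot_self_cross u (velocity u)
    rw [dotProduct] at h0
    simp only [hcr] at h0
    have : (∑ i, RatFunc.C (c i) * ratD (x i)) * r = 0 := by
      rw [← h0, Finset.sum_mul]
      refine Finset.sum_congr rfl fun i _ => ?_
      rw [hu, velocity_apply]
      ring
    exact (mul_eq_zero.1 this).resolve_right hr

/-! ### Transformation of the invariants under substitutions -/

/-- The squared determinant is the Gram determinant, arranged so that `w ⬝ᵥ w` can be solved for
when `u × v` has nonzero square. -/
theorem gram_three {R : Type*} [CommRing R] (u v w : Fin 3 → R) :
    (crossProduct u v ⬝ᵥ w) ^ 2 =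
      (crossProduct u v ⬝ᵥ crossProduct u v) * (w ⬝ᵥ w) -
        ((u ⬝ᵥ u) * (v ⬝ᵥ w) ^ 2 + (v ⬝ᵥ v) * (u ⬝ᵥ w) ^ 2 -
          2 * (u ⬝ᵥ v) * (v ⬝ᵥ w) * (u ⬝ᵥ w)) := by
  simp only [Matrix.vec3_dotProduct, cross_apply, Matrix.cons_val]
  ring

theorem curvatureSq_eq (x : RatParam) : curvatureSq x =
    (crossProduct (velocity x) (velocity (velocity x)) ⬝ᵥ
      crossProduct (velocity x) (velocity (velocity x))) / (velocity x ⬝ᵥ velocity x) ^ 3 := rfl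

theorem torsion_eq (x : RatParam) : torsion x = tripleDet x /
    (crossProduct (velocity x) (velocity (velocity x)) ⬝ᵥ
      crossProduct (velocity x) (velocity (velocity x))) := rfl

section Substitution

variable (σ : RatFunc ℝ →ₐ[ℝ] RatFunc ℝ) (x : RatParam)

theorem velocity_algHom (i : Fin 3) :
    velocity (fun i => σ (x i)) i = σ (velocity x i) * ratD (σ RatFunc.X) :=
  ratD_algHom σ (x i)

theorem velocity_velocity_algHom (i : Fin 3) :
    velocity (velocity fun i => σ (x i)) i =
      σ (velocity (velocity x) i) * ratD (σ RatFunc.X) ^ 2 +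
        σ (velocity x i) * ratD (ratD (σ RatFunc.X)) := by
  rw [velocity_apply, velocity_algHom, ratD_mul, ratD_algHom σ (velocity x i), ← velocity_apply]
  ring

theorem velocity_velocity_velocity_algHom (i : Fin 3) :
    velocity (velocity (velocity fun i => σ (x i))) i =
      σ (velocity (velocity (velocity x)) i) * ratD (σ RatFunc.X) ^ 3 +
        3 * σ (velocity (velocity x) i) * ratD (σ RatFunc.X) * ratD (ratD (σ RatFunc.X)) +
        σ (velocity x i) * ratD (ratD (ratD (σ RatFunc.X))) := by
  rw [velocity_apply, velocity_velocity_algHom, map_add, ratD_mul, ratD_mul, pow_two, ratD_mul,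
    ratD_algHom σ (velocity (velocity x) i), ratD_algHom σ (velocity x i), ← velocity_apply,
    ← velocity_apply]
  ring

/-- The `φ''` term of the second derivative is parallel to the velocity and drops out, leaving `φ' ·
φ'²`. -/
theorem crossProduct_algHom (i : Fin 3) :
    crossProduct (velocity fun i => σ (x i)) (velocity (velocity fun i => σ (x i))) i =
      σ (crossProduct (velocity x) (velocity (velocity x)) i) * ratD (σ RatFunc.X) ^ 3 := by
  fin_cases i <;>
    simp [cross_apply, velocity_algHom, velocity_velocity_algHom] <;> ring

variable (hσ : ratD (σ RatFunc.X) ≠ 0)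
include hσ

theorem curvatureSq_algHom : curvatureSq (fun i => σ (x i)) = σ (curvatureSq x) := by
  rw [curvatureSq_eq, curvatureSq_eq]
  simp only [Matrix.vec3_dotProduct, crossProduct_algHom, velocity_algHom, map_div₀, map_add,
    map_mul, map_pow]
  -- Numerator and denominator both acquire the factor `φ'⁶`.
  have h6 := pow_ne_zero 6 hσ
  conv_rhs => rw [← mul_div_mul_right _ _ h6]
  congr 1 <;> ring

theorem torsion_algHom : torsion (fun i => σ (x i)) = σ (torsion x) := by
  rw [torsion_eq, torsion_eq, tripleDet, tripleDet]
  have h6 := pow_ne_zero 6 hσ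
  rw [map_div₀]
  conv_rhs => rw [← mul_div_mul_right _ _ h6]
  congr 1
  · simp only [Matrix.vec3_dotProduct, cross_apply, Matrix.cons_val, velocity_algHom,
      velocity_velocity_algHom, velocity_velocity_velocity_algHom, map_add, map_sub, map_mul]
    ring
  · simp only [Matrix.vec3_dotProduct, crossProduct_algHom, map_add, map_mul]
    ring

end Substitution

/-! ### Transformation of the invariants under similarities -/

theorem velocity_affineImage (M : Matrix (Fin 3) (Fin 3) ℝ) (b : Fin 3 → ℝ) (x : RatParam) :
    velocity (affineImage M b x) = affineImage M 0 (velocity x) := by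
  funext i
  simp [velocity_apply, affineImage]

theorem affineImage_dotProduct {lam : ℝ} {Q : Matrix (Fin 3) (Fin 3) ℝ}
    (hQ : Q.transpose * Q = 1) (u v : RatParam) :
    affineImage (lam • Q) 0 u ⬝ᵥ affineImage (lam • Q) 0 v = RatFunc.C lam ^ 2 * (u ⬝ᵥ v) := by
  have e : ∀ j k, RatFunc.C (∑ i, Q i j * Q i k) = RatFunc.C (if j = k then 1 else 0) := by
    intro j k
    congr 1
    rw [← Matrix.one_apply, ← hQ, Matrix.mul_apply]
    rfl
  have e00 := e 0 0
  have e01 := e 0 1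
  have e02 := e 0 2
  have e11 := e 1 1
  have e12 := e 1 2
  have e22 := e 2 2
  simp [Fin.sum_univ_three] at e00 e01 e02 e11 e12 e22
  simp only [dotProduct, affineImage, Fin.sum_univ_three, Matrix.smul_apply, smul_eq_mul, map_mul,
    Pi.zero_apply, map_zero, add_zero]
  linear_combination RatFunc.C lam ^ 2 * (u 0 * v 0 * e00 + (u 0 * v 1 + u 1 * v 0) * e01 +
    (u 0 * v 2 + u 2 * v 0) * e02 + u 1 * v 1 * e11 + (u 1 * v 2 + u 2 * v 1) * e12 +
    u 2 * v 2 * e22)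

theorem affineImage_tripleProduct {lam : ℝ} {Q : Matrix (Fin 3) (Fin 3) ℝ} (hQ : Q.det = 1)
    (u v w : RatParam) :
    crossProduct (affineImage (lam • Q) 0 u) (affineImage (lam • Q) 0 v) ⬝ᵥ
      affineImage (lam • Q) 0 w = RatFunc.C lam ^ 3 * (crossProduct u v ⬝ᵥ w) := by
  have e := congrArg RatFunc.C hQ
  rw [Matrix.det_fin_three] at e
  simp only [map_add, map_sub, map_mul, map_one] at e
  simp only [Matrix.vec3_dotProduct, cross_apply, Matrix.cons_val, affineImage, Fin.sum_univ_three,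
    Matrix.smul_apply, smul_eq_mul, map_mul, Pi.zero_apply, map_zero, add_zero]
  linear_combination RatFunc.C lam ^ 3 * ((u 1 * v 2 - u 2 * v 1) * w 0 +
    (u 2 * v 0 - u 0 * v 2) * w 1 + (u 0 * v 1 - u 1 * v 0) * w 2) * e

section Similarity

variable {lam : ℝ} {Q : Matrix (Fin 3) (Fin 3) ℝ} (b : Fin 3 → ℝ) (x : RatParam)

theorem speedSq_affineImage (hQ : Q.transpose * Q = 1) :
    velocity (affineImage (lam • Q) b x) ⬝ᵥ velocity (affineImage (lam • Q) b x) =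
      RatFunc.C lam ^ 2 * (velocity x ⬝ᵥ velocity x) := by
  rw [velocity_affineImage, affineImage_dotProduct hQ]

theorem curvatureSq_affineImage (hlam : lam ≠ 0) (hQ : Q.transpose * Q = 1) :
    curvatureSq x = RatFunc.C lam ^ 2 * curvatureSq (affineImage (lam • Q) b x) := by
  have hL : RatFunc.C lam ≠ 0 := by simpa using hlam
  -- Lagrange's identity reduces the cross products to dot products; the numerator scales by `λ⁴`
  -- and the denominator by `λ⁶`.
  simp only [curvatureSq_eq, velocity_affineImage, cross_dot_cross, affineImage_dotProduct hQ]
  rw [← mul_div_mul_left _ (_ ^ 3) (pow_ne_zero 6 hL), ← mul_div_assoc]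
  congr 1 <;> ring

/-- The triple product scales by `λ³` because `det Q = 1`, the denominator by `λ⁴`; torsion
therefore sees the sign of `λ`. -/
theorem torsion_affineImage (hlam : lam ≠ 0) (hQ : Q.transpose * Q = 1) (hQ' : Q.det = 1) :
    torsion x = RatFunc.C lam * torsion (affineImage (lam • Q) b x) := by
  have hL : RatFunc.C lam ≠ 0 := by simpa using hlam
  simp only [torsion_eq, tripleDet, velocity_affineImage, affineImage_tripleProduct hQ',
    cross_dot_cross, affineImage_dotProduct hQ]
  rw [← mul_div_mul_left (_ ⬝ᵥ _) _ (pow_ne_zero 4 hL), ← mul_div_assoc]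
  congr 1 <;> ring

end Similarity

/-! ### Congruence of parametrizations with proportional invariants -/

theorem map_ratD_mul (A B : Matrix (Fin 3) (Fin 3) (RatFunc ℝ)) :
    (A * B).map ratD = A.map ratD * B + A * B.map ratD := by
  ext i j
  simp only [Matrix.map_apply, Matrix.mul_apply, Matrix.add_apply, Fin.sum_univ_three, map_add,
    ratD_mul]
  ring

/-- The matrix whose rows are the first three derivatives. -/
def jet (x : RatParam) : Matrix (Fin 3) (Fin 3) (RatFunc ℝ) :=
  Matrix.of ![velocity x, velocity (velocity x), velocity (velocity (velocity x))]

theorem det_jet (x : RatParam) : (jet x).det = tripleDet x := by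
  simp only [jet, tripleDet, Matrix.det_fin_three, Matrix.vec3_dotProduct, cross_apply,
    Matrix.of_apply, Matrix.cons_val]
  ring

theorem jet_ratD_zero (x : RatParam) (j : Fin 3) : ratD (jet x 0 j) = jet x 1 j := rfl

theorem jet_ratD_one (x : RatParam) (j : Fin 3) : ratD (jet x 1 j) = jet x 2 j := rfl

theorem jet_mul_transpose_apply (x : RatParam) (i j : Fin 3) :
    (jet x * (jet x).transpose) i j = jet x i ⬝ᵥ jet x j := rfl

/-- The Gram matrix of the jet is determined by the speed, the curvature and the torsion. -/
theorem gram_jet_eq {lam : ℝ} (hlam : lam ≠ 0) {x y : RatParam} (hx : tripleDet x ≠ 0)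
    (hspeed : velocity y ⬝ᵥ velocity y = RatFunc.C lam ^ 2 * (velocity x ⬝ᵥ velocity x))
    (hcurv : curvatureSq x = RatFunc.C lam ^ 2 * curvatureSq y)
    (htors : torsion x = RatFunc.C lam * torsion y) :
    jet y * (jet y).transpose = RatFunc.C lam ^ 2 • (jet x * (jet x).transpose) ∧
      tripleDet y = RatFunc.C lam ^ 3 * tripleDet x := by
  have hL : RatFunc.C lam ≠ 0 := by simpa using hlam
  have hDL : ∀ r, ratD (RatFunc.C lam ^ 2 * r) = RatFunc.C lam ^ 2 * ratD r := fun r => by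
    rw [← map_pow, ratD_mul, ratD_C, mul_zero, add_zero]
  have hw : crossProduct (velocity x) (velocity (velocity x)) ≠ 0 := fun h => hx (by
    rw [tripleDet, h, zero_dotProduct])
  have hs : velocity x ⬝ᵥ velocity x ≠ 0 := fun h => hw (by
    rw [eq_zero_of_dotProduct_self h, map_zero, LinearMap.zero_apply])
  have hww : crossProduct (velocity x) (velocity (velocity x)) ⬝ᵥ
      crossProduct (velocity x) (velocity (velocity x)) ≠ 0 :=
    fun h => hw (eq_zero_of_dotProduct_self h)
  have hww' : crossProduct (velocity y) (velocity (velocity y)) ⬝ᵥ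
      crossProduct (velocity y) (velocity (velocity y)) = RatFunc.C lam ^ 4 *
      (crossProduct (velocity x) (velocity (velocity x)) ⬝ᵥ
        crossProduct (velocity x) (velocity (velocity x))) := by
    rw [curvatureSq_eq, curvatureSq_eq, hspeed] at hcurv
    field_simp at hcurv
    linear_combination -hcurv
  have htd : tripleDet y = RatFunc.C lam ^ 3 * tripleDet x := by
    rw [torsion_eq, torsion_eq, hww'] at htors
    field_simp at htors
    linear_combination -htors
  have hsqx := gram_three (velocity x) (velocity (velocity x)) (velocity (velocity (velocity x)))
  have hsqy := gram_three (velocity y) (velocity (velocity y)) (velocity (velocity (velocity y)))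
  change tripleDet x ^ 2 = _ at hsqx
  change tripleDet y ^ 2 = _ at hsqy
  have h12 := congrArg ratD hspeed
  rw [hDL, ratD_dotProduct, ratD_dotProduct, dotProduct_comm (velocity (velocity y)),
    dotProduct_comm (velocity (velocity x))] at h12
  replace h12 : velocity y ⬝ᵥ velocity (velocity y) =
      RatFunc.C lam ^ 2 * (velocity x ⬝ᵥ velocity (velocity x)) := by
    linear_combination h12 / 2
  -- Lagrange's identity for `‖y' × y''‖²`, solved for `‖y''‖²`; the other dot products come from
  -- differentiating known ones.
  have h22 : velocity (velocity y) ⬝ᵥ velocity (velocity y) =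
      RatFunc.C lam ^ 2 * (velocity (velocity x) ⬝ᵥ velocity (velocity x)) := by
    have e := hww'
    rw [cross_dot_cross, cross_dot_cross, dotProduct_comm (velocity (velocity y)) (velocity y),
      dotProduct_comm (velocity (velocity x)) (velocity x), h12, hspeed] at e
    refine mul_left_cancel₀ (mul_ne_zero (pow_ne_zero 2 hL) hs) ?_
    linear_combination e
  have h23 := congrArg ratD h22
  rw [hDL, ratD_dotProduct, ratD_dotProduct, dotProduct_comm (velocity (velocity (velocity y))),
    dotProduct_comm (velocity (velocity (velocity x)))] at h23
  replace h23 : velocity (velocity y) ⬝ᵥ velocity (velocity (velocity y)) =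
      RatFunc.C lam ^ 2 * (velocity (velocity x) ⬝ᵥ velocity (velocity (velocity x))) := by
    linear_combination h23 / 2
  have h13 := congrArg ratD h12
  rw [hDL, ratD_dotProduct, ratD_dotProduct] at h13
  replace h13 : velocity y ⬝ᵥ velocity (velocity (velocity y)) =
      RatFunc.C lam ^ 2 * (velocity x ⬝ᵥ velocity (velocity (velocity x))) := by
    linear_combination h13 - h22
  -- In the Gram determinant identity only `‖y'''‖²` is still unknown, and its coefficient is `‖y' ×
  -- y''‖² ≠ 0`.
  have h33 : velocity (velocity (velocity y)) ⬝ᵥ velocity (velocity (velocity y)) =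
      RatFunc.C lam ^ 2 *
        (velocity (velocity (velocity x)) ⬝ᵥ velocity (velocity (velocity x))) := by
    rw [htd, hww', hspeed, h12, h22, h23, h13] at hsqy
    refine mul_left_cancel₀ (mul_ne_zero (pow_ne_zero 4 hL) hww) ?_
    linear_combination RatFunc.C lam ^ 6 * hsqx - hsqy
  refine ⟨?_, htd⟩
  ext i j
  rw [Matrix.smul_apply, jet_mul_transpose_apply, jet_mul_transpose_apply, smul_eq_mul]
  fin_cases i <;> fin_cases j
  · exact hspeed
  · exact h12
  · exact h13
  · exact (dotProduct_comm _ _).trans (h12.trans (congrArg _ (dotProduct_comm _ _)))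
  · exact h22
  · exact h23
  · exact (dotProduct_comm _ _).trans (h13.trans (congrArg _ (dotProduct_comm _ _)))
  · exact (dotProduct_comm _ _).trans (h23.trans (congrArg _ (dotProduct_comm _ _)))
  · exact h33

/-- An orthogonal matrix relating two jets has constant entries. -/
theorem map_ratD_eq_zero_of_jet_eq {lam : ℝ} (hlam : lam ≠ 0) {x y : RatParam}
    (hx : tripleDet x ≠ 0) {R : Matrix (Fin 3) (Fin 3) (RatFunc ℝ)}
    (hR : R * R.transpose = 1) (hjet : jet y = RatFunc.C lam • (jet x * R)) :
    R.map ratD = 0 := by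
  have hL : RatFunc.C lam ≠ 0 := by simpa using hlam
  set A := jet x with hA
  set R' := R.map ratD with hR'
  -- The derivative of row `k` of a jet is row `k + 1`, so differentiating `hjet` in that row leaves
  -- only the term with `R'`.
  have hrow : ∀ k : Fin 3, k ≠ 2 → ∀ j, (A * R') k j = 0 := by
    intro k hk j
    have e : ∀ k j, jet y k j = RatFunc.C lam * ∑ i, A k i * R i j := fun k j => by
      rw [hjet, Matrix.smul_apply, Matrix.mul_apply, smul_eq_mul]
    have hd := congrArg ratD (e k j)
    rw [ratD_mul, ratD_C, mul_zero, add_zero, map_sum] at hd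
    simp only [ratD_mul, Finset.sum_add_distrib] at hd
    rw [Matrix.mul_apply]
    refine (mul_eq_zero.1 (?_ : RatFunc.C lam * _ = 0)).resolve_left hL
    have hsum : ∀ l, (∑ i, R i j * A l i) = ∑ i, A l i * R i j := fun l =>
      Finset.sum_congr rfl fun i _ => mul_comm _ _
    fin_cases k
    · have h1 := e 1 j
      have h2 := hsum 1
      simp only [Fin.zero_eta, hA, jet_ratD_zero] at hd h1 h2 ⊢
      simp only [hR', Matrix.map_apply]
      linear_combination h1 - hd - RatFunc.C lam * h2
    · have h1 := e 2 j
      have h2 := hsum 2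
      simp only [Fin.mk_one, hA, jet_ratD_one] at hd h1 h2 ⊢
      simp only [hR', Matrix.map_apply]
      linear_combination h1 - hd - RatFunc.C lam * h2
    · exact absurd rfl hk
  have hskew : R' * R.transpose + R * R'.transpose = 0 := by
    have := map_ratD_mul R R.transpose
    rw [hR, Matrix.transpose_map] at this
    rw [← hR'] at this
    rw [← this]
    ext i j
    by_cases hij : i = j
    · simp [hij]
    · simp [hij]
  -- `S` is skew-symmetric since `R' Rᵀ` is, and its first two rows vanish; hence `S = 0`.
  -- Cancelling the invertible factors gives `R' = 0`.
  set S := A * R' * (R.transpose * A.transpose) with hS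
  have hST : S + S.transpose = 0 := by
    have : S + S.transpose = A * (R' * R.transpose + R * R'.transpose) * A.transpose := by
      simp only [hS, Matrix.transpose_mul, Matrix.transpose_transpose, Matrix.mul_add,
        Matrix.add_mul, Matrix.mul_assoc]
    rw [this, hskew, Matrix.mul_zero, Matrix.zero_mul]
  have hSrow : ∀ k : Fin 3, k ≠ 2 → ∀ j, S k j = 0 := fun k hk j => by
    rw [hS, Matrix.mul_apply]
    exact Finset.sum_eq_zero fun i _ => by rw [hrow k hk, zero_mul]
  have hS0 : S = 0 := by
    have hsk : ∀ i j, S i j + S j i = 0 := fun i j => congrFun (congrFun hST i) j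
    ext i j
    rw [Matrix.zero_apply]
    by_cases hi : i = 2
    · by_cases hj : j = 2
      · subst hi hj
        have := hsk 2 2
        rwa [← two_mul, mul_eq_zero, or_iff_right two_ne_zero] at this
      · have := hsk i j
        rwa [hSrow j hj, add_zero] at this
    · exact hSrow i hi j
  have hAu : IsUnit A := (Matrix.isUnit_iff_isUnit_det A).2 (by
    rw [hA, det_jet]; exact hx.isUnit)
  have hRu : IsUnit R.transpose := IsUnit.of_mul_eq_one R (mul_eq_one_comm.1 hR)
  have hATu : IsUnit A.transpose := (Matrix.isUnit_transpose A).2 hAu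
  rw [hS, (hRu.mul hATu).mul_left_eq_zero, hAu.mul_right_eq_zero] at hS0
  exact hS0

/-- Parametrizations with proportional speeds, curvatures and torsions are similar. -/
theorem exists_eq_affineImage {lam : ℝ} (hlam : lam ≠ 0) {x y : RatParam} (hx : tripleDet x ≠ 0)
    (hspeed : velocity y ⬝ᵥ velocity y = RatFunc.C lam ^ 2 * (velocity x ⬝ᵥ velocity x))
    (hcurv : curvatureSq x = RatFunc.C lam ^ 2 * curvatureSq y)
    (htors : torsion x = RatFunc.C lam * torsion y) :
    ∃ (Q : Matrix (Fin 3) (Fin 3) ℝ) (b : Fin 3 → ℝ), Q.transpose * Q = 1 ∧ Q.det = 1 ∧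
      y = affineImage (lam • Q) b x := by
  have hL : RatFunc.C lam ≠ 0 := by simpa using hlam
  obtain ⟨hgram, htd⟩ := gram_jet_eq hlam hx hspeed hcurv htors
  have hAdet : IsUnit (jet x).det := by rw [det_jet]; exact hx.isUnit
  set R := (RatFunc.C lam)⁻¹ • ((jet x)⁻¹ * jet y) with hRdef
  have hjet : jet y = RatFunc.C lam • (jet x * R) := by
    rw [hRdef, Matrix.mul_smul, smul_smul, mul_inv_cancel₀ hL, one_smul,
      Matrix.mul_nonsing_inv_cancel_left _ _ hAdet]
  have hR : R * R.transpose = 1 := by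
    have h1 : R * R.transpose = (RatFunc.C lam)⁻¹ ^ 2 • ((jet x)⁻¹ *
        (jet y * (jet y).transpose) * ((jet x)⁻¹).transpose) := by
      simp only [hRdef, Matrix.transpose_smul, Matrix.transpose_mul, Matrix.smul_mul,
        Matrix.mul_smul, smul_smul, Matrix.mul_assoc, pow_two]
    rw [h1, hgram, Matrix.mul_smul, Matrix.smul_mul, smul_smul, ← mul_pow, inv_mul_cancel₀ hL,
      one_pow, one_smul, Matrix.nonsing_inv_mul_cancel_left _ _ hAdet, ← Matrix.transpose_mul,
      Matrix.nonsing_inv_mul _ hAdet, Matrix.transpose_one]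
  -- The signed relation `det(jet y) = λ³ det(jet x)` excludes determinant `-1`.
  have hRdet : R.det = 1 := by
    have := congrArg Matrix.det hjet
    rw [Matrix.det_smul, Matrix.det_mul, det_jet, det_jet, htd, Fintype.card_fin] at this
    refine mul_left_cancel₀ (mul_ne_zero (pow_ne_zero 3 hL) hx) ?_
    linear_combination -this
  have hR' := map_ratD_eq_zero_of_jet_eq hlam hx hR hjet
  -- The indices are swapped because derivatives are rows of the jet, on which `R` acts from the
  -- right; thus `Q = Rᵀ`.
  have hconst : ∀ i j, ∃ q, R j i = RatFunc.C q := fun i j =>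
    exists_eq_C_of_ratD_eq_zero (congrFun (congrFun hR' j) i)
  choose Q hQ using hconst
  have hRQ : R.transpose = RatFunc.C.mapMatrix (Matrix.of Q) := by
    ext i j
    exact hQ i j
  have hinj : Function.Injective
      (RatFunc.C.mapMatrix : Matrix (Fin 3) (Fin 3) ℝ →+* Matrix (Fin 3) (Fin 3) (RatFunc ℝ)) :=
    Matrix.map_injective RatFunc.C_injective
  have hvel : ∀ i, velocity y i = ∑ j, RatFunc.C (lam * Q i j) * velocity x j := by
    intro i
    have := congrFun (congrFun hjet 0) i
    rw [Matrix.smul_apply, Matrix.mul_apply, smul_eq_mul, Finset.mul_sum] at this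
    refine this.trans (Finset.sum_congr rfl fun j _ => ?_)
    rw [hQ, map_mul]
    change RatFunc.C lam * (velocity x j * _) = _
    ring
  have htrans : ∀ i, ∃ b, y i - ∑ j, RatFunc.C (lam * Q i j) * x j = RatFunc.C b := fun i => by
    apply exists_eq_C_of_ratD_eq_zero
    rw [map_sub, map_sum, ← velocity_apply, hvel, sub_eq_zero]
    refine Finset.sum_congr rfl fun j _ => ?_
    rw [ratD_mul, ratD_C, mul_zero, add_zero, velocity_apply]
  choose b hb using htrans
  refine ⟨Matrix.of Q, b, hinj ?_, RatFunc.C_injective ?_, ?_⟩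
  · rw [map_mul, map_one, ← hRQ, ← hR]
    congr 1
    rw [← Matrix.transpose_transpose R, hRQ]
    rfl
  · rw [RingHom.map_det, ← hRQ, Matrix.det_transpose, hRdet, map_one]
  · funext i
    rw [affineImage, ← hb]
    simp

/-! ### Moebius substitutions -/

theorem ratD_algHom_X_ne_zero (σ : RatFunc ℝ →ₐ[ℝ] RatFunc ℝ) : ratD (σ RatFunc.X) ≠ 0 := by
  intro h
  obtain ⟨c, hc⟩ := exists_eq_C_of_ratD_eq_zero h
  have : σ RatFunc.X = σ (RatFunc.C c) := by
    rw [hc, ← RatFunc.algebraMap_eq_C, AlgHom.commutes]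
  have h1 := ratD_X
  rw [σ.injective this, ratD_C] at h1
  exact zero_ne_one h1

/-- The rational function `(a t + b) / (c t + d)`. -/
def moebiusRat (a b c d : ℝ) : RatFunc ℝ :=
  algebraMap ℝ[X] (RatFunc ℝ) (C a * X + C b) / algebraMap ℝ[X] (RatFunc ℝ) (C c * X + C d)

section Moebius

variable {a b c d : ℝ}

theorem linear_ne_zero (h : a * d - b * c ≠ 0) : (C c * X + C d : ℝ[X]) ≠ 0 := by
  intro h0
  have h1 := congrArg (fun p => coeff p 1) h0
  have h2 := congrArg (fun p => coeff p 0) h0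
  simp at h1 h2
  exact h (by rw [h1, h2]; ring)

theorem ratD_moebiusRat (h : (C c * X + C d : ℝ[X]) ≠ 0) :
    ratD (moebiusRat a b c d) = algebraMap ℝ[X] (RatFunc ℝ) (C (a * d - b * c)) /
      algebraMap ℝ[X] (RatFunc ℝ) ((C c * X + C d) ^ 2) := by
  rw [ratD_apply, moebiusRat, ratDeriv_div _ _ h]
  congr 2
  simp
  ring

/-- A nonconstant rational function is transcendental over `ℝ`, hence may be substituted for `X`. -/
theorem exists_algHom_moebiusRat (h : a * d - b * c ≠ 0) :
    ∃ σ : RatFunc ℝ →ₐ[ℝ] RatFunc ℝ, σ RatFunc.X = moebiusRat a b c d := by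
  have hne : ¬ ∃ k, moebiusRat a b c d = RatFunc.C k := by
    rintro ⟨k, hk⟩
    have h0 := ratD_moebiusRat (a := a) (b := b) (linear_ne_zero h)
    rw [hk, ratD_C, eq_comm, div_eq_zero_iff] at h0
    rcases h0 with h0 | h0
    · exact RatFunc.algebraMap_ne_zero (C_ne_zero.2 h) h0
    · exact RatFunc.algebraMap_ne_zero (pow_ne_zero 2 (linear_ne_zero h)) h0
  refine ⟨(IntermediateField.val _).comp (RatFunc.algEquivOfTranscendental _
    (RatFunc.transcendental_of_ne_C _ hne)).toAlgHom, ?_⟩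
  exact RatFunc.algEquivOfTranscendental_X _ _

theorem eventually_val_moebiusRat (h : a * d - b * c ≠ 0) :
    ∀ᶠ t in cofinite, val (moebiusRat a b c d) t = moebius a b c d t := by
  filter_upwards [eventually_val_div (algebraMap ℝ[X] (RatFunc ℝ) (C a * X + C b))
    (RatFunc.algebraMap_ne_zero (linear_ne_zero h))] with t ht
  rw [moebiusRat, ht, val_algebraMap, val_algebraMap, moebius]
  simp

theorem moebiusPoly_eq : moebiusPoly a b c d =
    C (C c * X + C d : ℝ[X]) * X - C (C a * X + C b) := by
  simp [moebiusPoly, inT, inS]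

theorem isPrimitive_moebiusPoly (h : a * d - b * c ≠ 0) : (moebiusPoly a b c d).IsPrimitive := by
  intro r hr
  rw [C_dvd_iff_dvd_coeff, moebiusPoly_eq] at hr
  have h0 := hr 0
  have h1 := hr 1
  simp only [coeff_sub, coeff_C_mul, coeff_X_zero, coeff_X_one, coeff_C_zero, mul_zero, zero_sub,
    mul_one, dvd_neg, coeff_C_of_ne_zero one_ne_zero, sub_zero] at h0 h1
  -- This constant is `a (c t + d) - c (a t + b)`.
  have h2 : r ∣ C (a * d - b * c) := by
    have := dvd_sub (h1.mul_left (C a)) (h0.mul_left (C c))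
    convert this using 1
    simp
    ring
  exact isUnit_of_dvd_unit h2 (isUnit_C.2 h.isUnit)

/-- By Gauss's lemma divisibility may be tested in `ℝ(t)[s]`, where `F` is a unit times `s - φ(t)`.
-/
theorem moebiusPoly_dvd_iff (h : a * d - b * c ≠ 0) (p : BiPoly) :
    moebiusPoly a b c d ∣ p ↔
      p.eval₂ (algebraMap ℝ[X] (RatFunc ℝ)) (moebiusRat a b c d) = 0 := by
  have hne := RatFunc.algebraMap_ne_zero (linear_ne_zero h)
  rw [(isPrimitive_moebiusPoly h).dvd_iff_fraction_map_dvd_fraction_map (RatFunc ℝ)]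
  have hmap : (moebiusPoly a b c d).map (algebraMap ℝ[X] (RatFunc ℝ)) =
      C (algebraMap ℝ[X] (RatFunc ℝ) (C c * X + C d)) * (X - C (moebiusRat a b c d)) := by
    rw [moebiusPoly_eq, mul_sub, ← C_mul, moebiusRat, mul_div_cancel₀ _ hne]
    simp
  rw [hmap, (isUnit_C.2 hne.isUnit).mul_left_dvd, dvd_iff_isRoot, IsRoot, eval_map]

end Moebius

theorem eval₂_cleared (σ : RatFunc ℝ →ₐ[ℝ] RatFunc ℝ) (r₁ r₂ : RatFunc ℝ) (m : ℝ) :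
    (cleared r₁ r₂ m).eval₂ (algebraMap ℝ[X] (RatFunc ℝ)) (σ RatFunc.X) = 0 ↔
      r₁ = RatFunc.C m * σ r₂ := by
  have hS : ∀ p : ℝ[X], (inS p).eval₂ (algebraMap ℝ[X] (RatFunc ℝ)) (σ RatFunc.X) =
      aeval (σ RatFunc.X) p := by
    intro p
    rw [inS, eval₂_map, RatFunc.algebraMap_comp_C, aeval_def, RatFunc.algebraMap_eq_C]
  have hd : aeval (σ RatFunc.X) r₂.denom ≠ 0 := by
    rw [aeval_algHom_apply, RatFunc.aeval_X_left_eq_algebraMap]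
    simpa using RatFunc.algebraMap_ne_zero r₂.denom_ne_zero
  have hd' := RatFunc.algebraMap_ne_zero r₁.denom_ne_zero
  simp only [cleared, eval₂_sub, eval₂_mul, hS, inT, eval₂_C, RatFunc.algebraMap_C]
  rw [algHom_eq_aeval_div σ r₂]
  conv_rhs => rw [← RatFunc.num_div_denom r₁]
  rw [← mul_div_assoc, div_eq_div_iff hd' hd, sub_eq_zero, mul_assoc]

theorem dvd_polyG_iff {p : BiPoly} {x₁ x₂ : RatParam} {lam : ℝ} :
    p ∣ polyG x₁ x₂ lam ↔ p ∣ polyK x₁ x₂ lam ∧ p ∣ polyT x₁ x₂ lam := by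
  let := UniqueFactorizationMonoid.toGCDMonoid BiPoly
  exact dvd_gcd_iff _ _ _

/-- Divisibility of `polyG` by the Moebius polynomial expresses the relations between the
curvatures and the torsions. -/
theorem moebiusPoly_dvd_polyG_iff {a b c d : ℝ} (h : a * d - b * c ≠ 0)
    {σ : RatFunc ℝ →ₐ[ℝ] RatFunc ℝ} (hσ : σ RatFunc.X = moebiusRat a b c d) (x₁ x₂ : RatParam)
    (lam : ℝ) :
    moebiusPoly a b c d ∣ polyG x₁ x₂ lam ↔
      curvatureSq x₁ = RatFunc.C lam ^ 2 * curvatureSq (fun i => σ (x₂ i)) ∧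
        torsion x₁ = RatFunc.C lam * torsion (fun i => σ (x₂ i)) := by
  have hσ' := ratD_algHom_X_ne_zero σ
  rw [dvd_polyG_iff, moebiusPoly_dvd_iff h, moebiusPoly_dvd_iff h, ← hσ, polyK, polyT,
    eval₂_cleared, eval₂_cleared, curvatureSq_algHom σ x₂ hσ', torsion_algHom σ x₂ hσ', map_pow]

/-! ### The arc-length relation -/

/-- Cofinite subsets of `ℝ` are open; this allows equalities valid off a finite set to be
differentiated. -/
theorem eventually_eventually_nhds {p : ℝ → Prop} (h : ∀ᶠ t in cofinite, p t) :
    ∀ᶠ t in cofinite, ∀ᶠ s in nhds t, p s := by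
  have ho : IsOpen {t | p t} := by
    rw [← isClosed_compl_iff]
    exact Set.Finite.isClosed h
  filter_upwards [h] with t ht
  exact ho.mem_nhds ht

theorem eventually_hasDerivAt_point (x : RatParam) :
    ∀ᶠ t in cofinite, HasDerivAt (point x) (point (velocity x) t) t := by
  filter_upwards [eventually_all.2 fun i => eventually_hasDerivAt_val (x i)] with t ht
  exact ((PiLp.continuousLinearEquiv 2 ℝ fun _ : Fin 3 => ℝ).symm.hasFDerivAt).comp_hasDerivAt t
    (hasDerivAt_pi.2 ht)

theorem eventually_point_moebius {a b c d : ℝ} (h : a * d - b * c ≠ 0)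
    {σ : RatFunc ℝ →ₐ[ℝ] RatFunc ℝ} (hσ : σ RatFunc.X = moebiusRat a b c d) (x : RatParam) :
    ∀ᶠ t in cofinite, (point x ∘ moebius a b c d) t = point (fun i => σ (x i)) t := by
  filter_upwards [eventually_all.2 fun i => eventually_val_algHom σ (x i),
    eventually_val_moebiusRat h] with t h1 h2
  ext i
  rw [Function.comp_apply, point_apply, point_apply, h1, hσ, h2]

/-- Both sides are nonnegative, so they may be squared. The squares agree with rational functions
off a finite set, and rational functions that agree there are equal. -/
theorem arcLengthRelation_iff {a b c d : ℝ} (h : a * d - b * c ≠ 0)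
    {σ : RatFunc ℝ →ₐ[ℝ] RatFunc ℝ} (hσ : σ RatFunc.X = moebiusRat a b c d) (x₁ x₂ : RatParam)
    (lam : ℝ) :
    ArcLengthRelation x₁ x₂ lam (moebius a b c d) ↔
      velocity (fun i => σ (x₂ i)) ⬝ᵥ velocity (fun i => σ (x₂ i)) =
        RatFunc.C lam ^ 2 * (velocity x₁ ⬝ᵥ velocity x₁) := by
  set y : RatParam := fun i => σ (x₂ i) with hy
  have key : ∀ᶠ t in cofinite,
      (|lam| * ‖deriv (point x₁) t‖ = ‖deriv (point x₂ ∘ moebius a b c d) t‖ ↔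
        val (velocity y ⬝ᵥ velocity y + RatFunc.C (-lam ^ 2) * (velocity x₁ ⬝ᵥ velocity x₁)) t
          = 0) := by
    filter_upwards [eventually_hasDerivAt_point x₁, eventually_hasDerivAt_point y,
      eventually_eventually_nhds (eventually_point_moebius h hσ x₂),
      eventually_norm_point_sq (velocity x₁), eventually_norm_point_sq (velocity y),
      eventually_val_add (velocity y ⬝ᵥ velocity y)
        (RatFunc.C (-lam ^ 2) * (velocity x₁ ⬝ᵥ velocity x₁)),
      eventually_val_mul (RatFunc.C (-lam ^ 2)) (velocity x₁ ⬝ᵥ velocity x₁)]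
      with t h1 h2 h3 h4 h5 h6 h7
    have h3' : point x₂ ∘ moebius a b c d =ᶠ[nhds t] point y := h3
    rw [h1.deriv, h3'.deriv_eq, h2.deriv, h6, h7, val_C, ← h4, ← h5,
      ← sq_eq_sq₀ (by positivity) (by positivity), mul_pow, sq_abs]
    constructor <;> intro e <;> linarith
  rw [ArcLengthRelation, eventually_congr key]
  have hz : velocity y ⬝ᵥ velocity y + RatFunc.C (-lam ^ 2) * (velocity x₁ ⬝ᵥ velocity x₁) = 0 ↔
      velocity y ⬝ᵥ velocity y = RatFunc.C lam ^ 2 * (velocity x₁ ⬝ᵥ velocity x₁) := by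
    rw [map_neg, map_pow, neg_mul, ← sub_eq_add_neg, sub_eq_zero]
  rw [← hz]
  refine ⟨eq_zero_of_eventually_val, fun e => Eventually.of_forall fun t => ?_⟩
  rw [e]
  simp [val_eq]

/-! ### Automorphisms of the field of rational functions -/

theorem IsProper.adjoin_eq_top {x : RatParam} (hx : IsProper x) :
    IntermediateField.adjoin ℝ (Set.range x) = ⊤ := by
  obtain ⟨P, Q, -, h⟩ := hx
  rw [← top_le_iff, ← RatFunc.adjoin_X, IntermediateField.adjoin_simple_le_iff,
    IntermediateField.mem_adjoin_range_iff]
  exact ⟨P, Q, h.symm⟩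

/-- If two parametrizations satisfy the same polynomial equations and the first is proper, then the
second one is obtained from the first by a substitution. -/
theorem exists_algHom_of_aeval_eq_zero_iff {x y : RatParam} (hx : IsProper x)
    (h : ∀ P : MvPolynomial (Fin 3) ℝ, MvPolynomial.aeval x P = 0 ↔ MvPolynomial.aeval y P = 0) :
    ∃ σ : RatFunc ℝ →ₐ[ℝ] RatFunc ℝ, ∀ i, σ (x i) = y i := by
  let f : MvPolynomial (Fin 3) ℝ →ₐ[ℝ] RatFunc ℝ := MvPolynomial.aeval x
  have hf : ∀ P, ((f.rangeRestrict P : f.range) : RatFunc ℝ) = MvPolynomial.aeval x P :=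
    fun _ => rfl
  -- Properness makes `ℝ(t)` the fraction field of `ℝ[x]`. One direction of `h` makes `x ↦ y` well
  -- defined on `ℝ[x]`, the other makes it injective.
  have : IsFractionRing f.range (RatFunc ℝ) := IsFractionRing.of_field _ _ fun z => by
    have hz : z ∈ IntermediateField.adjoin ℝ (Set.range x) := by
      rw [hx.adjoin_eq_top]; trivial
    obtain ⟨r, s, hrs⟩ := (IntermediateField.mem_adjoin_range_iff ℝ x z).1 hz
    exact ⟨f.rangeRestrict r, f.rangeRestrict s, hrs⟩
  let g : f.range →ₐ[ℝ] RatFunc ℝ := AlgHom.liftOfSurjective f.rangeRestrict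
    f.rangeRestrict_surjective (MvPolynomial.aeval y) fun P hP => (h P).1 (by
      rw [← hf]; exact congrArg Subtype.val hP)
  have hg : ∀ P, g (f.rangeRestrict P) = MvPolynomial.aeval y P :=
    AlgHom.liftOfSurjective_apply _ _ _ _
  have hinj : Function.Injective g := by
    rw [injective_iff_map_eq_zero]
    intro r hr
    obtain ⟨P, rfl⟩ := f.rangeRestrict_surjective r
    rw [hg, ← h] at hr
    exact Subtype.ext hr
  refine ⟨IsFractionRing.liftAlgHom hinj, fun i => ?_⟩
  have h1 : x i = algebraMap f.range (RatFunc ℝ) (f.rangeRestrict (MvPolynomial.X i)) :=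
    (MvPolynomial.aeval_X x i).symm
  rw [h1, IsFractionRing.liftAlgHom_apply, IsFractionRing.lift_algebraMap]
  exact (hg _).trans (MvPolynomial.aeval_X y i)

/-- The automorphisms of the field of rational functions are the Moebius substitutions. -/
theorem exists_moebiusRat_of_surjective {σ : RatFunc ℝ →ₐ[ℝ] RatFunc ℝ}
    (hσ : Function.Surjective σ) :
    ∃ a b c d : ℝ, a * d - b * c ≠ 0 ∧ σ RatFunc.X = moebiusRat a b c d := by
  have htop : IntermediateField.adjoin ℝ {σ RatFunc.X} = ⊤ := by
    rw [eq_top_iff]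
    intro r _
    obtain ⟨q, rfl⟩ := hσ r
    rw [IntermediateField.mem_adjoin_simple_iff]
    exact ⟨q.num, q.denom, algHom_eq_aeval_div σ q⟩
  -- The degree of `ℝ(t)` over `ℝ(σ X)` is the larger of the degrees of numerator and denominator,
  -- here 1.
  have hdeg := RatFunc.finrank_eq_max_natDegree (σ RatFunc.X)
  rw [htop, IntermediateField.finrank_top] at hdeg
  have hnum : (σ RatFunc.X).num.natDegree ≤ 1 := hdeg ▸ le_max_left _ _
  have hdenom : (σ RatFunc.X).denom.natDegree ≤ 1 := hdeg ▸ le_max_right _ _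
  obtain ⟨a, b, hab⟩ := exists_eq_X_add_C_of_natDegree_le_one hnum
  obtain ⟨c, d, hcd⟩ := exists_eq_X_add_C_of_natDegree_le_one hdenom
  have hm : σ RatFunc.X = moebiusRat a b c d := by
    rw [moebiusRat, ← hab, ← hcd, RatFunc.num_div_denom]
  refine ⟨a, b, c, d, fun h => ratD_algHom_X_ne_zero σ ?_, hm⟩
  rw [hm, ratD_moebiusRat (hcd ▸ RatFunc.denom_ne_zero _), h, C_0, map_zero, zero_div]

/-- The inverse affine map puts `x₁` in the range of `σ`, and `x₁` generates `ℝ(t)`. -/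
theorem surjective_of_algHom_eq_affineImage {x₁ x₂ : RatParam} (hx₁ : IsProper x₁)
    {M N : Matrix (Fin 3) (Fin 3) ℝ} (h : N * M = 1) {b : Fin 3 → ℝ}
    {σ : RatFunc ℝ →ₐ[ℝ] RatFunc ℝ} (hσ : ∀ i, σ (x₂ i) = affineImage M b x₁ i) :
    Function.Surjective σ := by
  have hC : ∀ c, RatFunc.C c ∈ σ.fieldRange := fun c => by
    rw [← RatFunc.algebraMap_eq_C]
    exact σ.fieldRange.algebraMap_mem c
  rw [← AlgHom.fieldRange_eq_top, ← top_le_iff, ← hx₁.adjoin_eq_top,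
    IntermediateField.adjoin_le_iff]
  rintro _ ⟨i, rfl⟩
  rw [← affineImage_affineImage_inv M N b h x₁]
  exact add_mem (sum_mem fun j _ => mul_mem (hC _) ⟨x₂ j, hσ j⟩) (hC _)

end SpaceCurve
end

theorem mainTheorem1 (x₁ x₂ : SpaceCurve.RatParam)
    (hx₁ : SpaceCurve.IsProper x₁) (hx₂ : SpaceCurve.IsProper x₂)
    (hC₁ : ¬ SpaceCurve.IsPlanar (SpaceCurve.curve x₁))
    (hC₂ : ¬ SpaceCurve.IsPlanar (SpaceCurve.curve x₂)) (lam₀ : ℝ) :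
    (∃ f : SpaceCurve.E3 → SpaceCurve.E3, SpaceCurve.IsSimilarity lam₀ f ∧
      f '' SpaceCurve.curve x₁ = SpaceCurve.curve x₂) ↔
    ∃ a b c d : ℝ, a * d - b * c ≠ 0 ∧
      SpaceCurve.moebiusPoly a b c d ∣ SpaceCurve.polyG x₁ x₂ lam₀ ∧
      SpaceCurve.ArcLengthRelation x₁ x₂ lam₀ (SpaceCurve.moebius a b c d) := by
  open SpaceCurve in
  constructor
  · rintro ⟨f, ⟨hlam, Q, b, hQ, hQ', hf⟩, hcurve⟩
    rw [image_curve hlam hQ hf, eq_comm, curve_eq_curve_iff] at hcurve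
    obtain ⟨σ, hσ⟩ := exists_algHom_of_aeval_eq_zero_iff hx₂ hcurve
    have hinv : (lam₀⁻¹ • Q.transpose) * (lam₀ • Q) = 1 := by
      rw [Matrix.smul_mul, Matrix.mul_smul, smul_smul, inv_mul_cancel₀ hlam, one_smul, hQ]
    obtain ⟨a, b', c, d, h, hm⟩ :=
      exists_moebiusRat_of_surjective (surjective_of_algHom_eq_affineImage hx₁ hinv hσ)
    refine ⟨a, b', c, d, h, (moebiusPoly_dvd_polyG_iff h hm x₁ x₂ lam₀).2 ?_,
      (arcLengthRelation_iff h hm x₁ x₂ lam₀).2 ?_⟩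
    · rw [funext hσ]
      exact ⟨curvatureSq_affineImage _ x₁ hlam hQ, torsion_affineImage _ x₁ hlam hQ hQ'⟩
    · rw [funext hσ]
      exact speedSq_affineImage _ x₁ hQ
  · rintro ⟨a, b, c, d, h, hdvd, harc⟩
    obtain ⟨σ, hσ⟩ := exists_algHom_moebiusRat h
    obtain ⟨hcurv, htors⟩ := (moebiusPoly_dvd_polyG_iff h hσ x₁ x₂ lam₀).1 hdvd
    have hspeed := (arcLengthRelation_iff h hσ x₁ x₂ lam₀).1 harc
    -- With ratio zero, `x₂ ∘ φ` would have zero velocity, contradicting nonplanarity of the second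
    -- curve.
    have hlam : lam₀ ≠ 0 := by
      rintro rfl
      rw [map_zero, zero_pow two_ne_zero, zero_mul] at hspeed
      refine tripleDet_ne_zero (x := fun i => σ (x₂ i)) (by rwa [curve_algHom]) ?_
      rw [tripleDet, eq_zero_of_dotProduct_self hspeed, map_zero, LinearMap.zero_apply,
        zero_dotProduct]
    obtain ⟨Q, v, hQ, hQ', hy⟩ :=
      exists_eq_affineImage hlam (tripleDet_ne_zero hC₁) hspeed hcurv htors
    refine ⟨fun p => lam₀ • Matrix.toEuclideanLin Q p + WithLp.toLp 2 v,
      ⟨hlam, Q, WithLp.toLp 2 v, hQ, hQ', fun _ => rfl⟩, ?_⟩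
    rw [image_curve hlam hQ (fun _ => rfl), ← curve_algHom σ x₂, hy]
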